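/- **Conventions.** Let $\mathcal L$ be an algebraic language and $\mathsf{Prop}$ an infinite set of variables; write $Tm$ for the set of terms (formulas) over $\mathsf{Prop}$ and $Eq$ for the set of equations $\gamma\approx\delta$ between such terms. Algebras are non-empty. A quasivariety is a class of $\mathcal L$-algebras closed under isomorphic copies, subalgebras and reduced products (over arbitrary, possibly empty, index sets and arbitrary, possibly improper, filters; so it contains the one-element algebras). A logic is a relation ${\vdash}\subseteq\mathcal P(Tm)\times Tm$ which is a consequence relation ($\Gamma\vdash\phi$ for $\phi\in\Gamma$; and $\Gamma\vdash\phi$ whenever $\Gamma\vdash\psi$ for all $\psi\in\Sigma$ and $\Sigma\vdash\phi$), is finitary (if $\Gamma\vdash\phi$ then $\Gamma_0\vdash\phi$ for some finite $\Gamma_0\subseteq\Gamma$) and is invariant under substitutions. For a class $\mathbf K$, $\Theta\vDash_{\mathbf K}\gamma\approx\delta$ means that every valuation into an algebra of $\mathbf K$ that satisfies all equations of $\Theta\subseteq Eq$ satisfies $\gamma\approx\delta$. Let $\vdash$ be a logic that is algebraizable with equivalent algebraic semantics the quasivariety $\mathbf Y$, witnessed by a finite set $\mu(x)$ of equations in one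 variable and a finite set $\Delta(x,y)$ of formulas in two variables: for all $\Gamma\cup\{\phi\}\subseteq Tm$ and $\Theta\cup\{\gamma\approx\delta\}\subseteq Eq$, (1) $\Gamma\vdash\phi$ iff $\mu[\Gamma]\vDash_{\mathbf Y}\mu(\phi)$; (2) $\Theta\vDash_{\mathbf Y}\gamma\approx\delta$ iff $\Delta[\Theta]\vdash\Delta(\gamma,\delta)$; (3) $\phi\dashv\vdash\Delta[\mu(\phi)]$; (4) $\gamma\approx\delta$ and $\mu[\Delta(\gamma,\delta)]$ entail each other under $\vDash_{\mathbf Y}$. Let $f(x)$ be a selector term, i.e. a term in one variable that is idempotent: the equation $f(f(x))\approx f(x)$ holds in $\mathbf Y$ (equivalently, $\vdash\Delta(f(f(x)),f(x))$). *Logics.* For $\chi\in Tm$ let $\chi^f$ be the result of replacing each variable $p$ in $\chi$ by $f(p)$. The $\mathsf{PAt}$-$f$-variant of a relation $\vdash_*$ is given by $\Gamma\vdash_*^f\phi$ iff $\{\chi^f:\chi\in\Gamma\}\vdash_*\phi^f$. A $\mathsf{PAt}$-$f$-logic is the $\mathsf{PAt}$-$f$-variant of some logic extending $\vdash$; $\Lambda^f(\vdash)$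 is the collection of these, ordered by inclusion. *Algebras.* For $\mathcal A\in\mathbf Y$ let $\mathcal A^f=\{a\in\mathcal A: f(a)=a\}$ be its set of $f$-regular elements; $\mathcal A$ is regularly generated if $\mathcal A^f$ generates it. For a subquasivariety $\mathbf K$ of $\mathbf Y$, let $\mathbf K^{\uparrow}$ be the class of all $\mathcal A\in\mathbf Y$ that have a subalgebra $\mathcal B\in\mathbf K$ with $\mathcal B^f=\mathcal A^f$. A $\mathsf{PAt}$-$f$-quasivariety is a subquasivariety of $\mathbf Y$ of the form $\mathbf K^{\uparrow}$ for some subquasivariety $\mathbf K$ of $\mathbf Y$; $\Xi^f(\mathbf Y)$ is the collection of these, ordered by inclusion. *Validity.* $\mathcal A\vDash_f(\Gamma,\phi)$ means that for every polyatomic valuation, i.e. every $v:\mathsf{Prop}\to\mathcal A^f$, if $v$ satisfies $\mu[\Gamma]$ then it satisfies $\mu(\phi)$; $\mathbf K\vDash_f(\Gamma,\phi)$ means this for all $\mathcal A\in\mathbf K$. Put $$\mathsf{QVar}^f(\vdash_s)=\{\mathcal A\in\mathbf Y:\mathcal A\vDash_f(\Gamma,\phi)\text{ whenever }\Gamma\vdash_s\phi\},\qquad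 \mathsf{Log}^f(\mathbf K)=\{(\Gamma,\phi):\mathbf K\vDash_f(\Gamma,\phi)\}.$$ **Theorem.** 1. (Algebraic completeness) For every $\mathsf{PAt}$-$f$-logic $\vdash_s$ and every pair $(\Gamma,\phi)$: $\Gamma\vdash_s\phi$ iff $\mathsf{QVar}^f(\vdash_s)\vDash_f(\Gamma,\phi)$. 2. For every $\mathsf{PAt}$-$f$-logic $\vdash_s$ and every pair $(\Gamma,\phi)$: $\Gamma\vdash_s\phi$ iff $\mathcal A\vDash_f(\Gamma,\phi)$ for all regularly generated $\mathcal A\in\mathsf{QVar}^f(\vdash_s)$. 3. $\mathsf{QVar}^f$ maps $\Lambda^f(\vdash)$ into $\Xi^f(\mathbf Y)$, $\mathsf{Log}^f$ maps $\Xi^f(\mathbf Y)$ into $\Lambda^f(\vdash)$, and for $\vdash_s\in\Lambda^f(\vdash)$ and $\mathbf K\in\Xi^f(\mathbf Y)$ we have $\mathsf{Log}^f(\mathsf{QVar}^f(\vdash_s))={\vdash_s}$ and $\mathsf{QVar}^f(\mathsf{Log}^f(\mathbf K))=\mathbf K$. 4. $\Lambda^f(\vdash)$ and $\Xi^f(\mathbf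 Y)$ are complete lattices, and $\mathsf{QVar}^f:\Lambda^f(\vdash)\to\Xi^f(\mathbf Y)$ is a dual (order-reversing) isomorphism between them, with inverse $\mathsf{Log}^f$. -/

import Mathlib

universe u v

namespace PolyatomicLogic

open FirstOrder FirstOrder.Language Set

/-! ### Algebras of a fixed type

An algebraic language is a first-order language without relation symbols (`L.IsAlgebraic`),
and an algebra is a nonempty structure for it. -/

/-- A (nonempty) algebra of type `L`. -/
structure Alg (L : FirstOrder.Language.{u, v}) where
  carrier : Type u
  [str : L.Structure carrier]
  [nonempty : Nonempty carrier]

attribute [instance] Alg.str Alg.nonempty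

namespace Alg

variable {L : FirstOrder.Language.{u, v}}

/-- A nonempty subuniverse of `A`, regarded as an algebra. -/
def sub (A : Alg L) (S : L.Substructure A.carrier) (hS : (S : Set A.carrier).Nonempty) : Alg L :=
  { carrier := S
    nonempty := hS.to_subtype }

/-- The pointwise operations on a direct product respect equality modulo a filter. -/
instance reducedPrestructure {I : Type u} (F : Filter I) (A : I → Alg L) :
    L.Prestructure (F.productSetoid fun i => (A i).carrier) :=
  { F.productSetoid (fun i => (A i).carrier) with
    toStructure :=
      { funMap := fun {_} g x i => Structure.funMap g fun k => x k i
        RelMap := fun {_} r x => ∀ᶠ i in F, Structure.RelMap r fun k => x k i }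
    fun_equiv := fun {n} g x y xy => by
      have h : ∀ᶠ i in F, ∀ k, x k i = y k i := Filter.eventually_all.2 xy
      exact h.mono fun i hi => congrArg (Structure.funMap g) (funext hi)
    rel_equiv := fun {n} r x y xy => by
      have h : ∀ᶠ i in F, ∀ k, x k i = y k i := Filter.eventually_all.2 xy
      refine propext (Filter.eventually_congr (h.mono fun i hi => ?_))
      rw [show (fun k => x k i) = fun k => y k i from funext hi] }

/-- The reduced product `∏ i, A i / F`. The index set may be empty and the filter may be
improper, so one-element algebras are reduced products. -/
def reducedProduct {I : Type u} (F : Filter I) (A : I → Alg L) : Alg L :=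
  { carrier := Quotient (F.productSetoid fun i => (A i).carrier)
    nonempty := ⟨Quotient.mk _ fun i => Classical.choice (A i).nonempty⟩ }

end Alg

section Basic

variable {L : FirstOrder.Language.{u, v}}

/-- Closed under isomorphic copies, subalgebras and reduced products. -/
structure IsQuasivariety (K : Set (Alg L)) : Prop where
  iso : ∀ A ∈ K, ∀ B : Alg L, Nonempty (A.carrier ≃[L] B.carrier) → B ∈ K
  sub : ∀ A ∈ K, ∀ (S : L.Substructure A.carrier) (hS : (S : Set A.carrier).Nonempty),
    A.sub S hS ∈ K
  reducedProduct : ∀ (I : Type u) (F : Filter I) (A : I → Alg L), (∀ i, A i ∈ K) →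
    Alg.reducedProduct F A ∈ K

/-- The collection `Ξ(Y)` of subquasivarieties of `Y`. -/
def subquasivarieties (Y : Set (Alg L)) : Set (Set (Alg L)) :=
  {K | K ⊆ Y ∧ IsQuasivariety K}

/-- Equations `γ ≈ δ` over the variables `X`, as pairs of terms. -/
abbrev Eqn (L : FirstOrder.Language.{u, v}) (X : Type*) := L.Term X × L.Term X

/-- A relation between sets of formulas and formulas, as a set of pairs `(Γ, φ)`. -/
abbrev SequentSet (L : FirstOrder.Language.{u, v}) (X : Type*) := Set (Set (L.Term X) × L.Term X)

/-! ### Logics -/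

structure IsConsequenceRelation {C : Type*} (R : Set (Set C × C)) : Prop where
  refl : ∀ (W : Set C) (a : C), a ∈ W → (W, a) ∈ R
  cut : ∀ (W V : Set C) (a : C), (∀ b ∈ V, (W, b) ∈ R) → (V, a) ∈ R → (W, a) ∈ R

def IsFinitary {C : Type*} (R : Set (Set C × C)) : Prop :=
  ∀ (W : Set C) (a : C), (W, a) ∈ R → ∃ V ⊆ W, V.Finite ∧ (V, a) ∈ R

/-- A finitary, substitution-invariant consequence relation on the terms over `X`. -/
structure IsLogic {X : Type*} (R : SequentSet L X) : Prop extends IsConsequenceRelation R where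
  finitary : IsFinitary R
  subst : ∀ (σ : X → L.Term X) (Γ : Set (L.Term X)) (φ : L.Term X), (Γ, φ) ∈ R →
    ((fun ψ : L.Term X => ψ.subst σ) '' Γ, φ.subst σ) ∈ R

/-- The collection `Λ(⊢)` of logics extending `⊢`. -/
def extensions {X : Type*} (R : SequentSet L X) : Set (SequentSet L X) :=
  {T | R ⊆ T ∧ IsLogic T}

/-! ### Equational consequence and algebraizability -/

/-- `A, v ⊨ Θ`. -/
def Satisfies {X : Type*} (A : Alg L) (v : X → A.carrier) (Θ : Set (Eqn L X)) : Prop :=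
  ∀ e ∈ Θ, e.1.realize v = e.2.realize v

/-- `Θ ⊨_K e`. -/
def EqConsequence {X : Type*} (K : Set (Alg L)) (Θ : Set (Eqn L X)) (e : Eqn L X) : Prop :=
  ∀ A ∈ K, ∀ v : X → A.carrier, Satisfies A v Θ → e.1.realize v = e.2.realize v

/-- The set of equations `μ(φ)`, for a set `μ(x)` of equations in one variable. -/
def muAt {X : Type*} (μ : Set (Eqn L Unit)) (φ : L.Term X) : Set (Eqn L X) :=
  (fun e : Eqn L Unit => (e.1.subst fun _ => φ, e.2.subst fun _ => φ)) '' μ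

/-- `μ[Γ]`, the union of the sets `μ(ψ)` for `ψ ∈ Γ`. -/
def muSet {X : Type*} (μ : Set (Eqn L Unit)) (Γ : Set (L.Term X)) : Set (Eqn L X) :=
  ⋃ ψ ∈ Γ, muAt μ ψ

/-- The set of formulas `Δ(γ, δ)`, for a set `Δ(x, y)` of formulas in two variables. -/
def deltaAt {X : Type*} (Δ : Set (L.Term (Fin 2))) (γ δ : L.Term X) : Set (L.Term X) :=
  (fun χ : L.Term (Fin 2) => χ.subst ![γ, δ]) '' Δ

/-- `Δ[Θ]`, the union of the sets `Δ(γ, δ)` for `γ ≈ δ` in `Θ`. -/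
def deltaSet {X : Type*} (Δ : Set (L.Term (Fin 2))) (Θ : Set (Eqn L X)) : Set (L.Term X) :=
  ⋃ e ∈ Θ, deltaAt Δ e.1 e.2

/-- The logic `R` is algebraizable with equivalent algebraic semantics the quasivariety `Y`, as
witnessed by the finite sets `μ(x)` and `Δ(x, y)`. -/
structure IsAlgebraizableVia {X : Type*} (R : SequentSet L X) (Y : Set (Alg L))
    (μ : Set (Eqn L Unit)) (Δ : Set (L.Term (Fin 2))) : Prop where
  quasivariety : IsQuasivariety Y
  mu_finite : μ.Finite
  delta_finite : Δ.Finite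
  sequent_iff : ∀ (Γ : Set (L.Term X)) (φ : L.Term X),
    (Γ, φ) ∈ R ↔ ∀ e ∈ muAt μ φ, EqConsequence Y (muSet μ Γ) e
  equation_iff : ∀ (Θ : Set (Eqn L X)) (γ δ : L.Term X),
    EqConsequence Y Θ (γ, δ) ↔ ∀ ψ ∈ deltaAt Δ γ δ, (deltaSet Δ Θ, ψ) ∈ R
  sequent_inverse : ∀ φ : L.Term X,
    (∀ ψ ∈ deltaSet Δ (muAt μ φ), ({φ}, ψ) ∈ R) ∧ (deltaSet Δ (muAt μ φ), φ) ∈ R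
  equation_inverse : ∀ γ δ : L.Term X,
    (∀ e ∈ muSet μ (deltaAt Δ γ δ), EqConsequence Y {(γ, δ)} e) ∧
      EqConsequence Y (muSet μ (deltaAt Δ γ δ)) (γ, δ)

/-! ### Selector terms and polyatomic logics -/

/-- The operation `f^A` given by the term `f(x)`. -/
def termOp (f : L.Term Unit) (A : Alg L) (a : A.carrier) : A.carrier :=
  f.realize fun _ => a

/-- `f` is idempotent: the equation `f(f(x)) ≈ f(x)` holds in `Y`. -/
def IsSelector (Y : Set (Alg L)) (f : L.Term Unit) : Prop :=
  ∀ A ∈ Y, ∀ a : A.carrier, termOp f A (termOp f A a) = termOp f A a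

/-- `χ[f(p)/p]`: every variable `p` is replaced by `f(p)`. -/
def substSelector {X : Type*} (f : L.Term Unit) (χ : L.Term X) : L.Term X :=
  χ.subst fun p => f.subst fun _ => Term.var p

/-- The PAt-`f`-variant of a relation: `Γ ⊢^f φ` iff `Γ[f(p)/p] ⊢ φ[f(p)/p]`. -/
def patVariant {X : Type*} (f : L.Term Unit) (T : SequentSet L X) : SequentSet L X :=
  {s | (substSelector f '' s.1, substSelector f s.2) ∈ T}

/-- The collection `Λ^f(⊢)` of PAt-`f`-logics. -/
def patLogics {X : Type*} (R : SequentSet L X) (f : L.Term Unit) : Set (SequentSet L X) :=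
  {S | ∃ T ∈ extensions R, S = patVariant f T}

/-! ### Regular elements and polyatomic quasivarieties -/

/-- The set `A^f` of `f`-regular elements of `A`. -/
def regular (f : L.Term Unit) (A : Alg L) : Set A.carrier :=
  {a | termOp f A a = a}

/-- `A` is generated by its regular elements. -/
def RegularlyGenerated (f : L.Term Unit) (A : Alg L) : Prop :=
  Substructure.closure L (regular f A) = ⊤

/-- The PAt-`f`-variant of a class `K`: the algebras `A` in `Y` that have a subalgebra in `K`
with the same regular elements as `A`. -/
def coreVariant (Y : Set (Alg L)) (f : L.Term Unit) (K : Set (Alg L)) : Set (Alg L) :=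
  {A | A ∈ Y ∧ ∃ (S : L.Substructure A.carrier) (hS : (S : Set A.carrier).Nonempty),
    A.sub S hS ∈ K ∧ Subtype.val '' regular f (A.sub S hS) = regular f A}

/-- The collection `Ξ^f(Y)` of PAt-`f`-quasivarieties. -/
def patQuasivarieties (Y : Set (Alg L)) (f : L.Term Unit) : Set (Set (Alg L)) :=
  {K | K ∈ subquasivarieties Y ∧ ∃ K' ∈ subquasivarieties Y, K = coreVariant Y f K'}

/-- `A, v ⊨ (Γ, φ)`. -/
def SatisfiesSequent {X : Type*} (μ : Set (Eqn L Unit)) (A : Alg L) (v : X → A.carrier)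
    (s : Set (L.Term X) × L.Term X) : Prop :=
  Satisfies A v (muSet μ s.1) → Satisfies A v (muAt μ s.2)

/-- `A ⊨_f (Γ, φ)`: truth under all polyatomic valuations, i.e. valuations into regular
elements. -/
def PatValid {X : Type*} (μ : Set (Eqn L Unit)) (f : L.Term Unit) (A : Alg L)
    (s : Set (L.Term X) × L.Term X) : Prop :=
  ∀ v : X → A.carrier, (∀ p, v p ∈ regular f A) → SatisfiesSequent μ A v s

/-- `QVar^f(S)`: the algebras in `Y` that validate `S` under polyatomic valuations. -/
def patQVar {X : Type*} (Y : Set (Alg L)) (μ : Set (Eqn L Unit)) (f : L.Term Unit)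
    (S : SequentSet L X) : Set (Alg L) :=
  {A | A ∈ Y ∧ ∀ s ∈ S, PatValid μ f A s}

/-- `Log^f(K)`: the pairs validated by all algebras in `K` under polyatomic valuations. -/
def patLog (X : Type*) (μ : Set (Eqn L Unit)) (f : L.Term Unit) (K : Set (Alg L)) :
    SequentSet L X :=
  {s | ∀ A ∈ K, PatValid μ f A s}

end Basic

end PolyatomicLogic

open FirstOrder PolyatomicLogic

/-! Let `T` be a logic extending `R` and let `Mod T` be the class of all algebras in `Y` validating
`T` under all valuations. For the selector term `x` every valuation is polyatomic, so `Mod` is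
`patQVar Y μ (Term.var ())` and the ordinary logic of a class is given by
`patLog X μ (Term.var ())`. The theorem is reduced to this case.

In the ordinary case, both compositions are identities. If `Γ ⊬ φ` in `T`, the quotient of the term
algebra by the equations `γ ≈ δ` with `Γ ⊢ Δ(γ, δ)` is a countermodel in `Mod T`
(`IsAlgebraizableVia.patLog_patQVar_var`); that it lies in `Y`, and that a subquasivariety is
recovered from its logic (`IsAlgebraizableVia.patQVar_patLog_var`), both follow from Maltsev's theorem
that a quasivariety contains every algebra satisfying its quasi-equations
(`IsQuasivariety.mem_of_eqConsequence`). The logic of a quasivariety is finitary because the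
quasivariety is closed under reduced products.

The passage to polyatomic valuations rests on two facts. Since `f` is idempotent, the valuations
`f ∘ v` are exactly the polyatomic ones, so a sequent is polyatomically valid iff its selector
translation is valid (`patValid_iff_substSelector`, `patLog_eq_patVariant`). And if `A` validates the
variant of `T` polyatomically, the subalgebra generated by its regular elements lies in `Mod T`:
finitely many elements of it are values of terms at regular elements, and `T` is invariant under
substitution (`sub_closure_mem_patQVar_var`). Hence the polyatomic class of the variant of `T` is
`(Mod T)^↑` (`patQVar_patVariant`), and as `K^↑ = K` for a `PAt`-`f`-quasivariety `K`, the two maps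
are mutually inverse. The intersection of `PAt`-`f`-quasivarieties is again one, which makes them a
complete lattice, and the dual isomorphism carries this over to the logics. -/

namespace PolyatomicLogic

open FirstOrder FirstOrder.Language Set

variable {L : FirstOrder.Language.{u, v}} {X : Type*} {μ : Set (Eqn L Unit)} {f : L.Term Unit}

/-! ### Designated elements -/

/-- The element `a` solves all the equations in `μ(x)`. The designated elements of `A` play the
role of the truth values: a valuation satisfies `μ(φ)` iff it sends `φ` to a designated element. -/
def Designated (μ : Set (Eqn L Unit)) (A : Alg L) (a : A.carrier) : Prop :=
  ∀ e ∈ μ, e.1.realize (fun _ => a) = e.2.realize fun _ => a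

theorem satisfies_muAt_iff {A : Alg L} {v : X → A.carrier} {φ : L.Term X} :
    Satisfies A v (muAt μ φ) ↔ Designated μ A (φ.realize v) := by
  simp only [Satisfies, muAt, Designated, forall_mem_image, Term.realize_subst]

theorem satisfies_muSet_iff {A : Alg L} {v : X → A.carrier} {Γ : Set (L.Term X)} :
    Satisfies A v (muSet μ Γ) ↔ ∀ ψ ∈ Γ, Designated μ A (ψ.realize v) := by
  simp only [← satisfies_muAt_iff, Satisfies, muSet, mem_iUnion]
  exact ⟨fun h ψ hψ e he => h e ⟨ψ, hψ, he⟩, fun h e ⟨ψ, hψ, he⟩ => h ψ hψ e he⟩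

theorem satisfiesSequent_iff {A : Alg L} {v : X → A.carrier} {Γ : Set (L.Term X)}
    {φ : L.Term X} : SatisfiesSequent μ A v (Γ, φ) ↔
      ((∀ ψ ∈ Γ, Designated μ A (ψ.realize v)) → Designated μ A (φ.realize v)) := by
  rw [SatisfiesSequent, satisfies_muAt_iff, satisfies_muSet_iff]

theorem realize_substSelector {A : Alg L} {v : X → A.carrier} (χ : L.Term X) :
    (substSelector f χ).realize v = χ.realize fun p => termOp f A (v p) := by
  simp only [substSelector, Term.realize_subst, termOp, Term.realize_var]

/-! ### Embeddings -/

theorem designated_embedding_iff {A B : Alg L} (j : A.carrier ↪[L] B.carrier) {a : A.carrier} :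
    Designated μ B (j a) ↔ Designated μ A a := by
  have key (t : L.Term Unit) : t.realize (fun _ => j a) = j (t.realize fun _ => a) :=
    HomClass.realize_term j (v := fun _ => a)
  simp only [Designated, key, j.injective.eq_iff]

theorem map_mem_regular_iff {A B : Alg L} (j : A.carrier ↪[L] B.carrier) {a : A.carrier} :
    j a ∈ regular f B ↔ a ∈ regular f A := by
  have key : f.realize (fun _ => j a) = j (f.realize fun _ => a) :=
    HomClass.realize_term j (v := fun _ => a)
  simp only [regular, termOp, mem_ofPred_eq, key, j.injective.eq_iff]

theorem satisfiesSequent_embedding_iff {A B : Alg L} (j : A.carrier ↪[L] B.carrier)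
    {v : X → A.carrier} {s : Set (L.Term X) × L.Term X} :
    SatisfiesSequent μ B (j ∘ v) s ↔ SatisfiesSequent μ A v s := by
  obtain ⟨Γ, φ⟩ := s
  simp only [satisfiesSequent_iff, HomClass.realize_term, designated_embedding_iff]

theorem PatValid.of_embedding {A B : Alg L} (j : A.carrier ↪[L] B.carrier)
    {s : Set (L.Term X) × L.Term X} (h : PatValid μ f B s) : PatValid μ f A s := fun v hv =>
  (satisfiesSequent_embedding_iff j).1 (h (j ∘ v) fun p => (map_mem_regular_iff j).2 (hv p))

/-- Polyatomic validity can be tested in any subalgebra containing the regular elements. -/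
theorem patValid_sub_iff {A : Alg L} {S : L.Substructure A.carrier}
    {hS : (S : Set A.carrier).Nonempty} (hreg : regular f A ⊆ S)
    {s : Set (L.Term X) × L.Term X} : PatValid μ f (A.sub S hS) s ↔ PatValid μ f A s := by
  refine ⟨fun h v hv => ?_, PatValid.of_embedding (A := A.sub S hS) S.subtype⟩
  let w : X → (A.sub S hS).carrier := fun p => (⟨v p, hreg (hv p)⟩ : S)
  exact (satisfiesSequent_embedding_iff (A := A.sub S hS) (v := w) S.subtype).2
    (h w fun p => (map_mem_regular_iff (A := A.sub S hS) S.subtype).1 (hv p))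

theorem image_regular_sub {A : Alg L} {S : L.Substructure A.carrier}
    {hS : (S : Set A.carrier).Nonempty} :
    Subtype.val '' regular f (A.sub S hS) = regular f A ∩ S := by
  ext a
  constructor
  · rintro ⟨b, hb, rfl⟩
    exact ⟨(map_mem_regular_iff (A := A.sub S hS) S.subtype).2 hb, b.2⟩
  · rintro ⟨ha, hS'⟩
    exact ⟨⟨a, hS'⟩, (map_mem_regular_iff (A := A.sub S hS) S.subtype).1 ha, rfl⟩

theorem image_regular_sub_eq_iff {A : Alg L} {S : L.Substructure A.carrier}
    {hS : (S : Set A.carrier).Nonempty} :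
    Subtype.val '' regular f (A.sub S hS) = regular f A ↔ regular f A ⊆ S := by
  rw [image_regular_sub, inter_eq_left]

theorem IsSelector.termOp_mem_regular {Y : Set (Alg L)} (hf : IsSelector Y f) {A : Alg L}
    (hA : A ∈ Y) (a : A.carrier) : termOp f A a ∈ regular f A := hf A hA a

theorem IsSelector.regular_nonempty {Y : Set (Alg L)} (hf : IsSelector Y f) {A : Alg L}
    (hA : A ∈ Y) : (regular f A).Nonempty :=
  ⟨_, hf.termOp_mem_regular hA (Classical.choice A.nonempty)⟩

/-- A quasivariety contains every algebra that embeds into one of its members. -/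
theorem IsQuasivariety.of_embedding {K : Set (Alg L)} (hK : IsQuasivariety K) {A B : Alg L}
    (hB : B ∈ K) (j : A.carrier ↪[L] B.carrier) : A ∈ K := by
  have hne : (j.toHom.range : Set B.carrier).Nonempty :=
    ⟨j (Classical.choice A.nonempty), ⟨_, rfl⟩⟩
  exact hK.iso _ (hK.sub B hB j.toHom.range hne) A ⟨j.equivRange.symm⟩

/-! ### Reduced products -/

section ReducedProduct

variable {I : Type u} {F : Filter I} {A : I → Alg L}

/-- The class of `w` in the reduced product. -/
def reducedMk (F : Filter I) (A : I → Alg L) (w : ∀ i, (A i).carrier) :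
    (Alg.reducedProduct F A).carrier :=
  Quotient.mk (F.productSetoid fun i => (A i).carrier) w

theorem reducedMk_eq_iff {w w' : ∀ i, (A i).carrier} :
    reducedMk F A w = reducedMk F A w' ↔ ∀ᶠ i in F, w i = w' i :=
  Quotient.eq (r := F.productSetoid fun i => (A i).carrier)

theorem reducedMk_surjective : Function.Surjective (reducedMk F A) := Quotient.mk_surjective

theorem funMap_reducedMk {n : ℕ} (g : L.Functions n) (x : Fin n → ∀ i, (A i).carrier) :
    Structure.funMap g (fun k => reducedMk F A (x k)) =
      reducedMk F A fun i => Structure.funMap g fun k => x k i :=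
  funMap_quotient_mk' (F.productSetoid fun i => (A i).carrier) g x

theorem realize_reducedMk {C : Type*} (t : L.Term C) (w : C → ∀ i, (A i).carrier) :
    t.realize (fun c => reducedMk F A (w c)) =
      reducedMk F A fun i => t.realize fun c => w c i := by
  induction t with
  | var => rfl
  | func g ts ih => simp only [Term.realize_func, ih, funMap_reducedMk]

theorem designated_reducedMk_iff (hμ : μ.Finite) {w : ∀ i, (A i).carrier} :
    Designated μ (Alg.reducedProduct F A) (reducedMk F A w) ↔
      ∀ᶠ i in F, Designated μ (A i) (w i) := by
  have key (t : L.Term Unit) : t.realize (fun _ => reducedMk F A w) =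
    reducedMk F A fun i => t.realize fun _ => w i := realize_reducedMk t fun _ => w
  simp only [Designated, key, reducedMk_eq_iff]
  exact (Filter.eventually_all_finite hμ).symm

theorem reducedMk_mem_regular_iff {w : ∀ i, (A i).carrier} :
    reducedMk F A w ∈ regular f (Alg.reducedProduct F A) ↔ ∀ᶠ i in F, w i ∈ regular f (A i) := by
  have key : f.realize (fun _ => reducedMk F A w) =
    reducedMk F A fun i => f.realize fun _ => w i := realize_reducedMk f fun _ => w
  simp only [regular, termOp, mem_ofPred_eq, key, reducedMk_eq_iff]

end ReducedProduct

/-! ### Finitely many terms use finitely many variables -/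

theorem relabel_eq_self {C : Type*} [DecidableEq C] {g : C → C} {t : L.Term C}
    (h : ∀ c ∈ t.varFinset, g c = c) : t.relabel g = t := by
  induction t with
  | var c => simpa [Term.relabel, Term.varFinset] using h
  | func F ts ih =>
    simp only [Term.relabel, Term.func.injEq, heq_eq_eq, true_and]
    funext i
    exact ih i fun c hc => h c (by simpa [Term.varFinset] using ⟨i, hc⟩)

/-- A finite set of terms over any nonempty set of variables can be renamed into a given infinite
set of variables and back. -/
theorem exists_relabel_retraction {C X : Type*} [Nonempty C] [Infinite X] {F : Set (L.Term C)}
    (hF : F.Finite) : ∃ (r : C → X) (s : X → C), ∀ t ∈ F, (t.relabel r).relabel s = t := by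
  classical
  have hW : (⋃ t ∈ F, (t.varFinset : Set C)).Finite :=
    hF.biUnion fun t _ => t.varFinset.finite_toSet
  obtain ⟨g, hg⟩ := Set.countable_iff_exists_injOn.1 hW.countable
  have hr : InjOn (Infinite.natEmbedding X ∘ g) (⋃ t ∈ F, (t.varFinset : Set C)) :=
    (Infinite.natEmbedding X).injective.comp_injOn hg
  refine ⟨Infinite.natEmbedding X ∘ g, Function.invFunOn (Infinite.natEmbedding X ∘ g)
    (⋃ t ∈ F, (t.varFinset : Set C)), fun t ht => ?_⟩
  rw [Term.relabel_relabel]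
  exact relabel_eq_self fun c hc => hr.leftInvOn_invFunOn (mem_biUnion ht hc)

/-! ### A quasivariety is determined by its quasi-equations -/

/-- If `A` satisfies the quasi-equations of `K`, then any finite part of the positive diagram of
`A` can be realized in a member of `K` keeping two given distinct elements of `A` apart. -/
theorem exists_valuation_separating {X : Type*} [Infinite X] {K : Set (Alg L)} {A : Alg L}
    (hA : ∀ (Θ : Set (Eqn L X)) (e : Eqn L X), EqConsequence K Θ e →
      ∀ v : X → A.carrier, Satisfies A v Θ → e.1.realize v = e.2.realize v)
    {F : Set (Eqn L A.carrier)} (hF : F.Finite) (hFA : Satisfies A id F) {a b : A.carrier}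
    (hab : a ≠ b) :
    ∃ B ∈ K, ∃ h : A.carrier → B.carrier, Satisfies B h F ∧ h a ≠ h b := by
  by_contra! hcon
  obtain ⟨r, s, hrs⟩ := exists_relabel_retraction (X := X)
    (((hF.image Prod.fst).union (hF.image Prod.snd)).union
      (toFinite {(Term.var a : L.Term A.carrier), Term.var b}))
  have hs (t : L.Term A.carrier) (ht : (t.relabel r).relabel s = t) :
      (t.relabel r).realize s = t.realize id :=
    (Term.realize_relabel (v := id)).symm.trans (congrArg _ ht)
  have hva := hs (Term.var a) (hrs _ (Or.inr (by simp)))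
  have hvb := hs (Term.var b) (hrs _ (Or.inr (by simp)))
  refine hab (hva.symm.trans ((hA ((fun e => (e.1.relabel r, e.2.relabel r)) '' F)
    ((Term.var a).relabel r, (Term.var b).relabel r) ?_ s ?_).trans hvb))
  · intro B hB w hw
    refine hcon B hB (w ∘ r) fun e he => ?_
    simpa only [Term.realize_relabel] using hw _ (mem_image_of_mem _ he)
  · rintro _ ⟨e, he, rfl⟩
    change (e.1.relabel r).realize s = (e.2.relabel r).realize s
    rw [hs e.1 (hrs _ (Or.inl (Or.inl ⟨e, he, rfl⟩))),
      hs e.2 (hrs _ (Or.inl (Or.inr ⟨e, he, rfl⟩)))]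
    exact hFA e he

/-- Maltsev's theorem: an algebra satisfying all quasi-equations of a quasivariety belongs to it.
The algebra is embedded into a reduced product indexed by the finite sets of equations over
its elements together with the pairs of distinct elements. The filter constrains only the finite
sets, so that every pair of distinct elements is kept apart. For a one-element algebra
the index set is empty and the reduced product has one element as well. -/
theorem IsQuasivariety.mem_of_eqConsequence [L.IsAlgebraic] {X : Type*} [Infinite X]
    {K : Set (Alg L)} (hK : IsQuasivariety K) {A : Alg L}
    (hA : ∀ (Θ : Set (Eqn L X)) (e : Eqn L X), EqConsequence K Θ e →
      ∀ v : X → A.carrier, Satisfies A v Θ → e.1.realize v = e.2.realize v) : A ∈ K := by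
  classical
  let D : Set (Eqn L A.carrier) := {e | e.1.realize id = e.2.realize id}
  have hex (j : Finset (Eqn L A.carrier) × {p : A.carrier × A.carrier // p.1 ≠ p.2}) :
      ∃ B ∈ K, ∃ h : A.carrier → B.carrier,
        Satisfies B h (↑j.1 ∩ D) ∧ h j.2.1.1 ≠ h j.2.1.2 :=
    exists_valuation_separating hA (j.1.finite_toSet.inter_of_left D) (fun e he => he.2) j.2.2
  choose B hBK h hsat hne using hex
  let F : Filter (Finset (Eqn L A.carrier) × {p : A.carrier × A.carrier // p.1 ≠ p.2}) :=
    Filter.comap Prod.fst Filter.atTop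
  have hev (e : Eqn L A.carrier) (he : e ∈ D) :
      ∀ᶠ j in F, e.1.realize (h j) = e.2.realize (h j) := by
    refine Filter.Eventually.comap (p := fun s => e ∈ s) ?_ Prod.fst |>.mono
      fun j hj => hsat j e ⟨hj, he⟩
    exact (Filter.eventually_ge_atTop {e}).mono fun s hs => hs (Finset.mem_singleton_self e)
  refine hK.of_embedding (hK.reducedProduct _ F B hBK)
    { toFun := fun a => reducedMk F B fun j => h j a
      inj' := fun a b hab => ?_
      map_fun' := fun {n} g x => ?_
      map_rel' := fun r => isEmptyElim r }
  · by_contra hne'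
    have hab' := reducedMk_eq_iff.1 hab
    obtain ⟨s, hs⟩ := (Filter.eventually_comap.1 hab').exists
    exact hne (s, ⟨(a, b), hne'⟩) (hs _ rfl)
  · refine Eq.trans ?_ (funMap_reducedMk g fun k j => h j (x k)).symm
    exact reducedMk_eq_iff.2 (hev (Term.var (Structure.funMap g x),
      Term.func g fun k => Term.var (x k)) rfl)

/-! ### The identity selector and the selector translation -/

/-- For the selector term `x` every valuation is polyatomic, so that `patQVar` and `patLog` for
`x` are the maps between the ordinary extensions of the logic and the ordinary
subquasivarieties. -/
theorem patValid_var_iff {A : Alg L} {s : Set (L.Term X) × L.Term X} :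
    PatValid μ (Term.var ()) A s ↔ ∀ v : X → A.carrier, SatisfiesSequent μ A v s :=
  ⟨fun h v => h v fun _ => rfl, fun h v _ => h v⟩

theorem isSelector_var (Y : Set (Alg L)) : IsSelector Y (Term.var ()) := fun _ _ _ => rfl

/-- A sequent is polyatomically valid iff its selector translation is valid. -/
theorem patValid_iff_substSelector {Y : Set (Alg L)} (hf : IsSelector Y f) {A : Alg L}
    (hA : A ∈ Y) {Γ : Set (L.Term X)} {φ : L.Term X} : PatValid μ f A (Γ, φ) ↔
      PatValid μ (Term.var ()) A (substSelector f '' Γ, substSelector f φ) := by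
  simp only [patValid_var_iff, satisfiesSequent_iff, forall_mem_image, realize_substSelector]
  refine ⟨fun h v => satisfiesSequent_iff.1
    (h (fun p => termOp f A (v p)) fun p => hf.termOp_mem_regular hA _), fun h v hv => ?_⟩
  have hv' : (fun p => termOp f A (v p)) = v := funext hv
  simpa only [hv', satisfiesSequent_iff] using h v

theorem patLog_eq_patVariant {Y : Set (Alg L)} (hf : IsSelector Y f) {K : Set (Alg L)}
    (hK : K ⊆ Y) : patLog X μ f K = patVariant f (patLog X μ (Term.var ()) K) := by
  ext ⟨Γ, φ⟩
  exact forall₂_congr fun A hA => patValid_iff_substSelector hf (hK hA)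

/-! ### The class of a finitary relation is a quasivariety -/

theorem isQuasivariety_patQVar {Y : Set (Alg L)} (hY : IsQuasivariety Y) (hμ : μ.Finite)
    (hf : IsSelector Y f) {S : SequentSet L X} (hS : IsFinitary S) :
    IsQuasivariety (patQVar Y μ f S) where
  iso A hA B hAB := by
    obtain ⟨e⟩ := hAB
    exact ⟨hY.iso A hA.1 B ⟨e⟩, fun s hs => (hA.2 s hs).of_embedding e.symm.toEmbedding⟩
  sub A hA U hU := ⟨hY.sub A hA.1 U hU, fun s hs =>
    (hA.2 s hs).of_embedding (A := A.sub U hU) U.subtype⟩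
  reducedProduct I F A hA := by
    refine ⟨hY.reducedProduct I F A fun i => (hA i).1, fun ⟨Γ, φ⟩ hs v hv => ?_⟩
    choose w hw using fun p => reducedMk_surjective (v p)
    -- Replacing representatives `w` by `f(w)` makes all coordinates regular simultaneously.
    let w' : X → ∀ i, (A i).carrier := fun p i => termOp f (A i) (w p i)
    have hw' : v = fun p => reducedMk F A (w' p) := by
      funext p
      have hreg := hv p
      rw [← hw p, reducedMk_mem_regular_iff] at hreg
      rw [← hw p, reducedMk_eq_iff]
      exact hreg.mono fun i hi => hi.symm
    obtain ⟨V, hV, hVfin, hVS⟩ := hS Γ φ hs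
    rw [satisfiesSequent_iff, hw']
    simp only [realize_reducedMk, designated_reducedMk_iff hμ]
    intro h
    have hall := (Filter.eventually_all_finite hVfin).2 fun ψ hψ => h ψ (hV hψ)
    refine hall.mono fun i hi => satisfiesSequent_iff.1 ((hA i).2 _ hVS (fun p => w' p i) ?_) hi
    exact fun p => hf.termOp_mem_regular (hA i).1 _

/-! ### Quotients of the term algebra -/

/-- A set of equations closed under the equational consequence of `Y`. -/
def IsEqTheory (Y : Set (Alg L)) (θ : Set (Eqn L X)) : Prop :=
  ∀ (Θ : Set (Eqn L X)) (e : Eqn L X), Θ ⊆ θ → EqConsequence Y Θ e → e ∈ θ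

/-- The congruence of the term algebra given by an equational theory. -/
def IsEqTheory.setoid {Y : Set (Alg L)} {θ : Set (Eqn L X)} (h : IsEqTheory Y θ) :
    Setoid (L.Term X) where
  r a b := (a, b) ∈ θ
  iseqv :=
    { refl := fun a => h ∅ (a, a) (empty_subset _) fun _ _ _ _ => rfl
      symm := fun {a b} hab => h {(a, b)} (b, a) (singleton_subset_iff.2 hab)
        fun _ _ _ hv => (hv _ rfl).symm
      trans := fun {a b c} hab hbc => h {(a, b), (b, c)} (a, c)
        (insert_subset_iff.2 ⟨hab, singleton_subset_iff.2 hbc⟩)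
        fun _ _ _ hv => (hv (a, b) (by simp)).trans (hv (b, c) (by simp)) }

/-- The operations of the term algebra respect the congruence of an equational theory. -/
instance IsEqTheory.prestructure [L.IsAlgebraic] {Y : Set (Alg L)} {θ : Set (Eqn L X)}
    (h : IsEqTheory Y θ) : L.Prestructure h.setoid where
  toStructure :=
    { funMap := fun {_} g x => Term.func g x
      RelMap := fun {_} r _ => isEmptyElim r }
  fun_equiv {n g} x y hxy := by
    refine h (range fun i => (x i, y i)) (Term.func g x, Term.func g y)
      (range_subset_iff.2 hxy) fun A _ v hv => ?_
    simp only [Term.realize_func]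
    exact congrArg _ (funext fun i => hv _ (mem_range_self i))
  rel_equiv {_ r} := isEmptyElim r

/-- The quotient of the term algebra by an equational theory. -/
def IsEqTheory.quotient [L.IsAlgebraic] {X : Type u} [Nonempty X] {Y : Set (Alg L)}
    {θ : Set (Eqn L X)} (h : IsEqTheory Y θ) : Alg L where
  carrier := Quotient h.setoid
  nonempty := ⟨Quotient.mk _ (Term.var (Classical.arbitrary X))⟩

section Quotient

variable [L.IsAlgebraic] {X : Type u} [Nonempty X] {Y : Set (Alg L)} {θ : Set (Eqn L X)}

/-- The class of the term `t` in the quotient by an equational theory. -/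
def IsEqTheory.mk (h : IsEqTheory Y θ) (t : L.Term X) : h.quotient.carrier :=
  Quotient.mk h.setoid t

theorem IsEqTheory.mk_eq_iff (h : IsEqTheory Y θ) {a b : L.Term X} :
    h.mk a = h.mk b ↔ (a, b) ∈ θ :=
  Quotient.eq (r := h.setoid)

theorem IsEqTheory.mk_surjective (h : IsEqTheory Y θ) : Function.Surjective h.mk :=
  Quotient.mk_surjective

theorem IsEqTheory.realize_mk (h : IsEqTheory Y θ) {C : Type*} (t : L.Term C)
    (σ : C → L.Term X) : t.realize (fun c => h.mk (σ c)) = h.mk (t.subst σ) := by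
  induction t with
  | var => rfl
  | func g ts ih =>
    simp only [Term.realize_func, ih]
    exact funMap_quotient_mk' h.setoid g fun k => (ts k).subst σ

theorem IsEqTheory.designated_mk_iff (h : IsEqTheory Y θ) {a : L.Term X} :
    Designated μ h.quotient (h.mk a) ↔ muAt μ a ⊆ θ := by
  simp only [Designated, muAt, image_subset_iff]
  refine forall₂_congr fun e _ => ?_
  rw [h.realize_mk e.1 fun _ => a, h.realize_mk e.2 fun _ => a, h.mk_eq_iff, mem_preimage]

theorem IsEqTheory.quotient_mem [Infinite X] (hY : IsQuasivariety Y) (h : IsEqTheory Y θ) :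
    h.quotient ∈ Y := by
  refine hY.mem_of_eqConsequence (X := X) fun Θ e hΘ v hv => ?_
  choose σ hσ using fun p => h.mk_surjective (v p)
  obtain rfl : (fun p => h.mk (σ p)) = v := funext hσ
  rw [h.realize_mk, h.realize_mk, h.mk_eq_iff]
  refine h ((fun d : Eqn L X => (d.1.subst σ, d.2.subst σ)) '' Θ) _ ?_ fun A hA w hw => ?_
  · rintro _ ⟨d, hd, rfl⟩
    have hd' := hv d hd
    rwa [h.realize_mk, h.realize_mk, h.mk_eq_iff] at hd'
  · simp only [Term.realize_subst]
    refine hΘ A hA _ fun d hd => ?_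
    simpa only [Term.realize_subst] using hw _ (mem_image_of_mem _ hd)

end Quotient

/-! ### Extensions of an algebraizable logic -/

section Extensions

variable {R T : SequentSet L X} {Y : Set (Alg L)} {Δ : Set (L.Term (Fin 2))}

/-- The equations `γ ≈ δ` with `Γ ⊢ Δ(γ, δ)` form an equational theory. -/
theorem IsAlgebraizableVia.isEqTheory (hY : IsAlgebraizableVia R Y μ Δ)
    (hT : T ∈ extensions R) (Γ : Set (L.Term X)) :
    IsEqTheory Y {e : Eqn L X | ∀ ψ ∈ deltaAt Δ e.1 e.2, (Γ, ψ) ∈ T} := by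
  intro Θ e hΘ he ψ hψ
  refine hT.2.cut Γ (deltaSet Δ Θ) ψ (fun χ hχ => ?_) (hT.1 ((hY.equation_iff Θ e.1 e.2).1 he ψ hψ))
  simp only [deltaSet, mem_iUnion] at hχ
  obtain ⟨d, hd, hχ⟩ := hχ
  exact hΘ hd χ hχ

theorem IsAlgebraizableVia.muAt_subset_iff (hY : IsAlgebraizableVia R Y μ Δ)
    (hT : T ∈ extensions R) {Γ : Set (L.Term X)} {φ : L.Term X} :
    muAt μ φ ⊆ {e : Eqn L X | ∀ ψ ∈ deltaAt Δ e.1 e.2, (Γ, ψ) ∈ T} ↔ (Γ, φ) ∈ T := by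
  refine Iff.trans (b := ∀ ψ ∈ deltaSet Δ (muAt μ φ), (Γ, ψ) ∈ T) ?_ ⟨fun h => ?_, fun h ψ hψ => ?_⟩
  · simp only [deltaSet, mem_iUnion]
    exact ⟨fun h ψ ⟨e, he, hψ⟩ => h he ψ hψ, fun h e he ψ hψ => h ψ ⟨e, he, hψ⟩⟩
  · exact hT.2.cut Γ _ φ h (hT.1 (hY.sequent_inverse φ).2)
  · refine hT.2.cut Γ {φ} ψ ?_ (hT.1 ((hY.sequent_inverse φ).1 ψ hψ))
    rintro _ rfl
    exact h

/-- Algebraic completeness of the extensions of an algebraizable logic: if `Γ ⊬ φ`, the quotient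
of the term algebra by the equations derivable from `Γ` is a countermodel. -/
theorem IsAlgebraizableVia.patLog_patQVar_var [L.IsAlgebraic] {X : Type u} [Infinite X]
    {R T : SequentSet L X} (hY : IsAlgebraizableVia R Y μ Δ) (hT : T ∈ extensions R) :
    patLog X μ (Term.var ()) (patQVar Y μ (Term.var ()) T) = T := by
  ext ⟨Γ, φ⟩
  refine ⟨fun h => ?_, fun h A hA => hA.2 _ h⟩
  have hθ := hY.isEqTheory hT Γ
  have hmem : hθ.quotient ∈ patQVar Y μ (Term.var ()) T := by
    refine ⟨hθ.quotient_mem hY.quasivariety, fun ⟨Ψ, ψ⟩ hs => patValid_var_iff.2 fun v => ?_⟩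
    choose σ hσ using fun p => hθ.mk_surjective (v p)
    obtain rfl : (fun p => hθ.mk (σ p)) = v := funext hσ
    simp only [satisfiesSequent_iff, hθ.realize_mk, hθ.designated_mk_iff, hY.muAt_subset_iff hT]
    intro h'
    refine hT.2.cut Γ _ _ ?_ (hT.2.subst σ Ψ ψ hs)
    rintro _ ⟨χ, hχ, rfl⟩
    exact h' χ hχ
  have hval := satisfiesSequent_iff.1
    (patValid_var_iff.1 (h _ hmem) fun p => hθ.mk (Term.var p))
  have hsub (χ : L.Term X) : χ.subst Term.var = χ := by
    induction χ with
    | var => rfl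
    | func g ts ih => exact congrArg (Term.func g) (funext ih)
  simp only [hθ.realize_mk, hθ.designated_mk_iff, hY.muAt_subset_iff hT, hsub] at hval
  exact hval fun ψ hψ => hT.2.refl Γ ψ hψ

end Extensions

/-! ### The logic of a quasivariety -/

/-- Finitarity is obtained from a reduced product over the finite sets of premises. -/
theorem isFinitary_patLog_var {X : Type u} {K : Set (Alg L)} (hK : IsQuasivariety K)
    (hμ : μ.Finite) : IsFinitary (patLog X μ (Term.var ()) K) := by
  classical
  intro Γ φ h
  by_contra! hcon
  have hex (j : Finset (L.Term X)) : ∃ A ∈ K, ∃ v : X → A.carrier,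
      (∀ ψ ∈ (↑j ∩ Γ : Set (L.Term X)), Designated μ A (ψ.realize v)) ∧
        ¬ Designated μ A (φ.realize v) := by
    have := hcon (↑j ∩ Γ) inter_subset_right (j.finite_toSet.inter_of_left Γ)
    simpa only [patLog, mem_ofPred_eq, patValid_var_iff, satisfiesSequent_iff, not_forall,
      exists_prop] using this
  choose A hA v hv hφ using hex
  have hval := satisfiesSequent_iff.1 (patValid_var_iff.1
    (h _ (hK.reducedProduct _ Filter.atTop A hA)) fun p => reducedMk Filter.atTop A fun j => v j p)
  simp only [realize_reducedMk, designated_reducedMk_iff hμ] at hval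
  obtain ⟨j, hj⟩ := (hval fun ψ hψ => (Filter.eventually_ge_atTop {ψ}).mono fun j hj =>
    hv j ψ ⟨hj (Finset.mem_singleton_self ψ), hψ⟩).exists
  exact hφ j hj

theorem isLogic_patLog_var {X : Type u} {K : Set (Alg L)} (hK : IsQuasivariety K)
    (hμ : μ.Finite) : IsLogic (patLog X μ (Term.var ()) K) where
  refl Γ φ hφ A _ v _ := satisfiesSequent_iff.2 fun h => h φ hφ
  cut Γ Ψ φ hΓ hφ A hA v hv := satisfiesSequent_iff.2 fun h =>
    satisfiesSequent_iff.1 (hφ A hA v hv) fun ψ hψ =>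
      satisfiesSequent_iff.1 (hΓ ψ hψ A hA v hv) h
  finitary := isFinitary_patLog_var hK hμ
  subst σ Γ φ h A hA := patValid_var_iff.2 fun v => by
    have := satisfiesSequent_iff.1 (patValid_var_iff.1 (h A hA) fun p => (σ p).realize v)
    simpa only [satisfiesSequent_iff, forall_mem_image, Term.realize_subst] using this

section

variable {R : SequentSet L X} {Y : Set (Alg L)} {Δ : Set (L.Term (Fin 2))}

theorem IsAlgebraizableVia.patLog_var_mem_extensions {X : Type u} {R : SequentSet L X}
    (hY : IsAlgebraizableVia R Y μ Δ) {K : Set (Alg L)} (hK : K ∈ subquasivarieties Y) :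
    patLog X μ (Term.var ()) K ∈ extensions R := by
  refine ⟨fun ⟨Γ, φ⟩ h A hA v _ hsat e he => ?_, isLogic_patLog_var hK.2 hY.mu_finite⟩
  exact (hY.sequent_iff Γ φ).1 h e he A (hK.1 hA) v hsat

/-- In the algebras of `Y` an equation holds iff the formulas `Δ` of its two sides are
designated. -/
theorem IsAlgebraizableVia.realize_eq_iff (hY : IsAlgebraizableVia R Y μ Δ) {A : Alg L}
    (hA : A ∈ Y) {v : X → A.carrier} {γ δ : L.Term X} :
    γ.realize v = δ.realize v ↔ ∀ ψ ∈ deltaAt Δ γ δ, Designated μ A (ψ.realize v) := by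
  rw [← satisfies_muSet_iff]
  refine ⟨fun h e he => (hY.equation_inverse γ δ).1 e he A hA v ?_,
    (hY.equation_inverse γ δ).2 A hA v⟩
  rintro _ rfl
  exact h

theorem IsAlgebraizableVia.satisfies_iff (hY : IsAlgebraizableVia R Y μ Δ) {A : Alg L}
    (hA : A ∈ Y) {v : X → A.carrier} {Θ : Set (Eqn L X)} :
    Satisfies A v Θ ↔ ∀ ψ ∈ deltaSet Δ Θ, Designated μ A (ψ.realize v) := by
  simp only [Satisfies, hY.realize_eq_iff hA, deltaSet, mem_iUnion]
  exact ⟨fun h ψ ⟨e, he, hψ⟩ => h e he ψ hψ, fun h e he ψ hψ => h ψ ⟨e, he, hψ⟩⟩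

/-- A subquasivariety of `Y` is determined by its logic: through `Δ` the quasi-equations of `K`
become sequents. -/
theorem IsAlgebraizableVia.patQVar_patLog_var [L.IsAlgebraic] [Infinite X]
    (hY : IsAlgebraizableVia R Y μ Δ) {K : Set (Alg L)} (hK : K ∈ subquasivarieties Y) :
    patQVar Y μ (Term.var ()) (patLog X μ (Term.var ()) K) = K := by
  refine Subset.antisymm (fun A hA => ?_) fun A hA => ⟨hK.1 hA, fun s hs => hs A hA⟩
  refine hK.2.mem_of_eqConsequence (X := X) fun Θ e he v hv => ?_
  rw [hY.realize_eq_iff hA.1]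
  rw [hY.satisfies_iff hA.1] at hv
  intro ψ hψ
  refine satisfiesSequent_iff.1 (patValid_var_iff.1 (hA.2 (deltaSet Δ Θ, ψ) ?_) v) hv
  refine fun B hB w _ => satisfiesSequent_iff.2 fun hw => ?_
  have hBY := hK.1 hB
  exact (hY.realize_eq_iff hBY).1 (he B hB w ((hY.satisfies_iff hBY).2 hw)) ψ hψ

end

/-! ### Regularly generated algebras -/

theorem closure_regular_nonempty {Y : Set (Alg L)} (hf : IsSelector Y f) {A : Alg L}
    (hA : A ∈ Y) : (Substructure.closure L (regular f A) : Set A.carrier).Nonempty :=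
  (hf.regular_nonempty hA).mono Substructure.subset_closure

theorem regularlyGenerated_sub_closure {A : Alg L}
    (hS : (Substructure.closure L (regular f A) : Set A.carrier).Nonempty) :
    RegularlyGenerated f (A.sub (Substructure.closure L (regular f A)) hS) := by
  let S := Substructure.closure L (regular f A)
  let j : (A.sub S hS).carrier ↪[L] A.carrier := S.subtype
  refine eq_top_iff.2 fun a _ => ?_
  have hmap : (Substructure.closure L (regular f (A.sub S hS))).map j.toHom = S :=
    (Substructure.map_closure j.toHom _).trans
      (congrArg _ (image_regular_sub_eq_iff.2 Substructure.subset_closure))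
  have ha : j a ∈ (Substructure.closure L (regular f (A.sub S hS))).map j.toHom := by
    rw [hmap]
    exact a.2
  obtain ⟨b, hb, hba⟩ := ha
  exact j.injective hba ▸ hb

theorem mem_of_mem_coreVariant {Y K : Set (Alg L)} (hK : IsQuasivariety K) {A : Alg L}
    (hgen : RegularlyGenerated f A) (hA : A ∈ coreVariant Y f K) : A ∈ K := by
  obtain ⟨-, S, hS, hSK, hreg⟩ := hA
  have htop : S = ⊤ := top_le_iff.1
    (hgen.symm.trans_le (Substructure.closure_le.2 (image_regular_sub_eq_iff.1 hreg)))
  subst htop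
  exact hK.of_embedding hSK Substructure.topEquiv.symm.toEmbedding

theorem mem_coreVariant_of_sub_closure_mem {Y K : Set (Alg L)} {A : Alg L} (hA : A ∈ Y)
    (hS : (Substructure.closure L (regular f A) : Set A.carrier).Nonempty)
    (h : A.sub (Substructure.closure L (regular f A)) hS ∈ K) : A ∈ coreVariant Y f K :=
  ⟨hA, _, hS, h, image_regular_sub_eq_iff.2 Substructure.subset_closure⟩

theorem subset_coreVariant {Y K : Set (Alg L)} (hf : IsSelector Y f)
    (hK : K ∈ subquasivarieties Y) : K ⊆ coreVariant Y f K := fun A hA =>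
  mem_coreVariant_of_sub_closure_mem (hK.1 hA) (closure_regular_nonempty hf (hK.1 hA))
    (hK.2.sub A hA _ _)

/-- The operation `K ↦ K^↑` is a closure operator, so that its values are closed under it. -/
theorem coreVariant_subset_of_mem_patQuasivarieties {Y K : Set (Alg L)} (hf : IsSelector Y f)
    (hK : K ∈ patQuasivarieties Y f) : coreVariant Y f K ⊆ K := by
  obtain ⟨hKY, K', hK', rfl⟩ := hK
  rintro A ⟨hA, S, hS, hSK, hreg⟩
  have hle : Substructure.closure L (regular f A) ≤ S :=
    Substructure.closure_le.2 (image_regular_sub_eq_iff.1 hreg)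
  have hne := closure_regular_nonempty hf hA
  refine mem_coreVariant_of_sub_closure_mem hA hne
    (mem_of_mem_coreVariant (Y := Y) hK'.2 (regularlyGenerated_sub_closure hne) ?_)
  exact hKY.2.of_embedding (A := A.sub _ hne) hSK (Substructure.inclusion hle)

/-- The elements of a regularly generated algebra are values of terms at regular elements; as only
finitely many of these matter for a finitary sequent, they can be named by variables, and
validity follows from polyatomic validity of a substitution instance. -/
theorem sub_closure_mem_patQVar_var {X : Type*} [Infinite X] {Y : Set (Alg L)}
    {T : SequentSet L X} (hY : IsQuasivariety Y) (hf : IsSelector Y f) (hT : IsLogic T)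
    {A : Alg L} (hA : A ∈ patQVar Y μ f (patVariant f T))
    (hS : (Substructure.closure L (regular f A) : Set A.carrier).Nonempty) :
    A.sub (Substructure.closure L (regular f A)) hS ∈ patQVar Y μ (Term.var ()) T := by
  let S := Substructure.closure L (regular f A)
  refine ⟨hY.sub A hA.1 _ _, fun ⟨Γ, φ⟩ hs => patValid_var_iff.2 fun v => ?_⟩
  let val : X → A.carrier := fun p => S.subtype (v p)
  refine (satisfiesSequent_embedding_iff (A := A.sub S hS) (B := A) S.subtype).1
    (show SatisfiesSequent μ A val (Γ, φ) from ?_)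
  obtain ⟨V, hVΓ, hVfin, hVT⟩ := hT.finitary Γ φ hs
  choose t ht using fun p => Substructure.mem_closure_iff_exists_term.1 (v p).2
  have : Nonempty (regular f A) := (hf.regular_nonempty hA.1).to_subtype
  obtain ⟨r, s, hrs⟩ := exists_relabel_retraction (X := X)
    ((hVfin.insert φ).image fun ψ : L.Term X => ψ.subst t)
  let w : X → A.carrier := fun x => (s x : A.carrier)
  have hw (ψ : L.Term X) (hψ : ψ ∈ insert φ V) :
      (ψ.subst fun p => (t p).relabel r).realize w = ψ.realize val := by
    have h1 : ψ.realize val = (ψ.subst t).realize Subtype.val := by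
      simp only [Term.realize_subst, ht]
      rfl
    rw [h1, ← hrs _ (mem_image_of_mem _ hψ)]
    simp only [Term.realize_subst, Term.realize_relabel]
    rfl
  have hval := satisfiesSequent_iff.1 (hA.2
    ((fun ψ : L.Term X => ψ.subst fun p => (t p).relabel r) '' V,
      φ.subst fun p => (t p).relabel r)
    (hT.subst _ _ _ (hT.subst _ _ _ hVT)) w fun x => (s x).2)
  rw [forall_mem_image, hw φ (mem_insert _ _)] at hval
  refine satisfiesSequent_iff.2 fun h => hval fun ψ hψ => ?_
  rw [hw ψ (mem_insert_of_mem _ hψ)]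
  exact h ψ (hVΓ hψ)

/-- The class of a `PAt`-`f`-variant is the `PAt`-`f`-variant of the class. -/
theorem patQVar_patVariant {X : Type*} [Infinite X] {Y : Set (Alg L)} {T : SequentSet L X}
    (hY : IsQuasivariety Y) (hf : IsSelector Y f) (hT : IsLogic T) :
    patQVar Y μ f (patVariant f T) = coreVariant Y f (patQVar Y μ (Term.var ()) T) := by
  ext A
  constructor
  · intro hA
    exact mem_coreVariant_of_sub_closure_mem hA.1 (closure_regular_nonempty hf hA.1)
      (sub_closure_mem_patQVar_var hY hf hT hA _)
  · rintro ⟨hA, S, hS, hSK, hreg⟩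
    refine ⟨hA, fun s hs => (patValid_sub_iff (hS := hS) (image_regular_sub_eq_iff.1 hreg)).1 ?_⟩
    exact (patValid_iff_substSelector hf hSK.1).2 (hSK.2 _ hs)

theorem IsFinitary.patVariant {T : SequentSet L X} (hT : IsFinitary T) :
    IsFinitary (patVariant f T) := by
  intro Γ φ h
  exact exists_subset_image_finite_and.1 (hT _ _ h)

/-! ### The correspondence between `PAt`-logics and `PAt`-quasivarieties -/

theorem IsAlgebraizableVia.patQVar_var_mem {R T : SequentSet L X} {Y : Set (Alg L)}
    {Δ : Set (L.Term (Fin 2))} (hY : IsAlgebraizableVia R Y μ Δ)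
    (hT : T ∈ extensions R) :
    patQVar Y μ (Term.var ()) T ∈ subquasivarieties Y :=
  ⟨fun _ hA => hA.1,
    isQuasivariety_patQVar hY.quasivariety hY.mu_finite (isSelector_var Y) hT.2.finitary⟩

theorem IsAlgebraizableVia.patQVar_mem [Infinite X] {R S : SequentSet L X}
    {Y : Set (Alg L)} {Δ : Set (L.Term (Fin 2))} (hY : IsAlgebraizableVia R Y μ Δ) (hf : IsSelector Y f)
    (hS : S ∈ patLogics R f) : patQVar Y μ f S ∈ patQuasivarieties Y f := by
  obtain ⟨T, hT, rfl⟩ := hS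
  exact ⟨⟨fun _ hA => hA.1, isQuasivariety_patQVar hY.quasivariety hY.mu_finite hf
    hT.2.finitary.patVariant⟩, _, hY.patQVar_var_mem hT,
    patQVar_patVariant hY.quasivariety hf hT.2⟩

theorem IsAlgebraizableVia.patLog_mem {X : Type u} {R : SequentSet L X} {Y K : Set (Alg L)}
    {Δ : Set (L.Term (Fin 2))} (hY : IsAlgebraizableVia R Y μ Δ) (hf : IsSelector Y f)
    (hK : K ∈ patQuasivarieties Y f) : patLog X μ f K ∈ patLogics R f :=
  ⟨_, hY.patLog_var_mem_extensions hK.1, patLog_eq_patVariant hf hK.1.1⟩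

section Correspondence

variable [L.IsAlgebraic] {X : Type u} [Infinite X] {R S : SequentSet L X} {Y K : Set (Alg L)}
  {Δ : Set (L.Term (Fin 2))}

theorem IsAlgebraizableVia.patLog_patQVar (hY : IsAlgebraizableVia R Y μ Δ)
    (hf : IsSelector Y f) (hS : S ∈ patLogics R f) : patLog X μ f (patQVar Y μ f S) = S := by
  refine Subset.antisymm (fun s hs => ?_) fun s hs A hA => hA.2 s hs
  obtain ⟨T, hT, rfl⟩ := hS
  have hsub := hY.patQVar_var_mem hT
  have hle : patQVar Y μ (Term.var ()) T ⊆ patQVar Y μ f (patVariant f T) :=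
    (subset_coreVariant hf hsub).trans (patQVar_patVariant hY.quasivariety hf hT.2).superset
  have hs' : s ∈ patLog X μ f (patQVar Y μ (Term.var ()) T) := fun A hA => hs A (hle hA)
  rwa [patLog_eq_patVariant hf hsub.1, hY.patLog_patQVar_var hT] at hs'

theorem IsAlgebraizableVia.patQVar_patLog (hY : IsAlgebraizableVia R Y μ Δ)
    (hf : IsSelector Y f) (hK : K ∈ patQuasivarieties Y f) :
    patQVar Y μ f (patLog X μ f K) = K := by
  rw [patLog_eq_patVariant hf hK.1.1, patQVar_patVariant hY.quasivariety hf
    (isLogic_patLog_var hK.1.2 hY.mu_finite), hY.patQVar_patLog_var hK.1]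
  exact (coreVariant_subset_of_mem_patQuasivarieties hf hK).antisymm (subset_coreVariant hf hK.1)

/-- The polyatomic validity of a sequent in `A` is that in the subalgebra generated by the regular
elements, so the regularly generated algebras suffice for completeness. -/
theorem IsAlgebraizableVia.mem_iff_regularlyGenerated (hY : IsAlgebraizableVia R Y μ Δ)
    (hf : IsSelector Y f) (hS : S ∈ patLogics R f) {s : Set (L.Term X) × L.Term X} :
    s ∈ S ↔ ∀ A ∈ patQVar Y μ f S, RegularlyGenerated f A → PatValid μ f A s := by
  refine ⟨fun hs A hA _ => hA.2 s hs, fun h => ?_⟩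
  rw [← hY.patLog_patQVar hf hS]
  intro A hA
  have hne := closure_regular_nonempty hf hA.1
  exact (patValid_sub_iff (hS := hne) Substructure.subset_closure).1
    (h _ ((hY.patQVar_mem hf hS).1.2.sub A hA _ hne) (regularlyGenerated_sub_closure hne))

/-- `QVar^f` as a dual order isomorphism with inverse `Log^f`. -/
def IsAlgebraizableVia.patIso (hY : IsAlgebraizableVia R Y μ Δ) (hf : IsSelector Y f) :
    patLogics R f ≃o (patQuasivarieties Y f)ᵒᵈ where
  toFun S := OrderDual.toDual ⟨patQVar Y μ f S.1, hY.patQVar_mem hf S.2⟩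
  invFun K := ⟨patLog X μ f (OrderDual.ofDual K).1, hY.patLog_mem hf (OrderDual.ofDual K).2⟩
  left_inv S := Subtype.ext (hY.patLog_patQVar hf S.2)
  right_inv K := Subtype.ext (hY.patQVar_patLog hf (OrderDual.ofDual K).2)
  map_rel_iff' {S T} := by
    refine ⟨fun h => ?_, fun h A hA => ⟨hA.1, fun s hs => hA.2 s (h hs)⟩⟩
    change S.1 ⊆ T.1
    rw [← hY.patLog_patQVar hf S.2, ← hY.patLog_patQVar hf T.2]
    exact fun s hs A hA => hs A (h hA)

end Correspondence

/-! ### Lattice structure -/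

theorem inter_sInter_mem_patQuasivarieties {Y : Set (Alg L)} (hY : IsQuasivariety Y)
    (hf : IsSelector Y f) {C : Set (Set (Alg L))} (hC : C ⊆ patQuasivarieties Y f) :
    Y ∩ ⋂₀ C ∈ patQuasivarieties Y f := by
  have hsub : Y ∩ ⋂₀ C ∈ subquasivarieties Y :=
    ⟨inter_subset_left,
      { iso := fun A hA B e => ⟨hY.iso A hA.1 B e, fun K hK =>
          (hC hK).1.2.iso A (hA.2 K hK) B e⟩
        sub := fun A hA S hS => ⟨hY.sub A hA.1 S hS, fun K hK =>
          (hC hK).1.2.sub A (hA.2 K hK) S hS⟩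
        reducedProduct := fun I F A hA => ⟨hY.reducedProduct I F A fun i => (hA i).1,
          fun K hK => (hC hK).1.2.reducedProduct I F A fun i => (hA i).2 K hK⟩ }⟩
  refine ⟨hsub, _, hsub, (subset_coreVariant hf hsub).antisymm ?_⟩
  rintro A ⟨hA, S, hS, hSK, hreg⟩
  exact ⟨hA, fun K hK => coreVariant_subset_of_mem_patQuasivarieties hf (hC hK)
    ⟨hA, S, hS, hSK.2 K hK, hreg⟩⟩

theorem exists_isGLB_patQuasivarieties {Y : Set (Alg L)} (hY : IsQuasivariety Y)
    (hf : IsSelector Y f) (C : Set (patQuasivarieties Y f)) : ∃ K, IsGLB C K := by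
  refine ⟨⟨Y ∩ ⋂₀ (Subtype.val '' C), inter_sInter_mem_patQuasivarieties hY hf ?_⟩,
    fun K hK A hA => hA.2 _ (mem_image_of_mem _ hK), fun K hK A hA => ⟨K.2.1.1 hA, ?_⟩⟩
  · rintro _ ⟨K, -, rfl⟩
    exact K.2
  · rintro _ ⟨K', hK', rfl⟩
    exact hK hK' hA

theorem exists_isLUB_patQuasivarieties {Y : Set (Alg L)} (hY : IsQuasivariety Y)
    (hf : IsSelector Y f) (C : Set (patQuasivarieties Y f)) : ∃ K, IsLUB C K :=
  (exists_isGLB_patQuasivarieties hY hf (upperBounds C)).imp fun _ h => isGLB_upperBounds.1 h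

end PolyatomicLogic

theorem mainTheorem1 {L : FirstOrder.Language.{u, v}} [L.IsAlgebraic] {X : Type u} [Infinite X]
    (R : SequentSet L X) (Y : Set (Alg L)) (μ : Set (Eqn L Unit)) (Δ : Set (L.Term (Fin 2)))
    (f : L.Term Unit) (hR : IsLogic R) (hY : IsAlgebraizableVia R Y μ Δ) (hf : IsSelector Y f) :
    -- completeness of every PAt-logic for its PAt-quasivariety
    (∀ S ∈ patLogics R f, ∀ (Γ : Set (L.Term X)) (φ : L.Term X),
      (Γ, φ) ∈ S ↔ ∀ A ∈ patQVar Y μ f S, PatValid μ f A (Γ, φ)) ∧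
    -- completeness for the regularly generated algebras
    (∀ S ∈ patLogics R f, ∀ (Γ : Set (L.Term X)) (φ : L.Term X),
      (Γ, φ) ∈ S ↔ ∀ A ∈ patQVar Y μ f S, RegularlyGenerated f A → PatValid μ f A (Γ, φ)) ∧
    -- the two maps are well defined and mutually inverse
    (∀ S ∈ patLogics R f, patQVar Y μ f S ∈ patQuasivarieties Y f ∧
      patLog X μ f (patQVar Y μ f S) = S) ∧
    (∀ K ∈ patQuasivarieties Y f, patLog X μ f K ∈ patLogics R f ∧
      patQVar Y μ f (patLog X μ f K) = K) ∧
    -- PAt-logics and PAt-quasivarieties form complete lattices under inclusion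
    (∀ C : Set (patLogics R f), (∃ S, IsLUB C S) ∧ ∃ S, IsGLB C S) ∧
    (∀ C : Set (patQuasivarieties Y f), (∃ K, IsLUB C K) ∧ ∃ K, IsGLB C K) ∧
    -- the map `QVar^f` is a dual isomorphism between them, with inverse `Log^f`
    (∃ e : patLogics R f ≃o (patQuasivarieties Y f)ᵒᵈ,
      (∀ S : patLogics R f,
        (OrderDual.ofDual (e S)).1 = patQVar Y μ f S.1) ∧
      ∀ K : patQuasivarieties Y f,
        (e.symm (OrderDual.toDual K)).1 = patLog X μ f K.1) := by
  have hglb := exists_isGLB_patQuasivarieties hY.quasivariety hf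
  have hlub := exists_isLUB_patQuasivarieties hY.quasivariety hf
  refine ⟨fun S hS Γ φ => ?_, fun S hS Γ φ => hY.mem_iff_regularlyGenerated hf hS,
    fun S hS => ⟨hY.patQVar_mem hf hS, hY.patLog_patQVar hf hS⟩,
    fun K hK => ⟨hY.patLog_mem hf hK, hY.patQVar_patLog hf hK⟩, fun C => ⟨?_, ?_⟩,
    fun C => ⟨hlub C, hglb C⟩, hY.patIso hf, fun _ => rfl, fun _ => rfl⟩
  · exact iff_of_eq (congrArg ((Γ, φ) ∈ ·) (hY.patLog_patQVar hf hS).symm)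
  · obtain ⟨K, hK⟩ := hglb (OrderDual.toDual ⁻¹' (hY.patIso hf '' C))
    exact ⟨_, (hY.patIso hf).isLUB_image.1 hK.dual⟩
  · obtain ⟨K, hK⟩ := hlub (OrderDual.toDual ⁻¹' (hY.patIso hf '' C))
    exact ⟨_, (hY.patIso hf).isGLB_image.1 hK.dual⟩
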